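/- Let $e_1,e_2,\ldots$ be independent standard exponentially distributed random variables, let $\gamma=0.577215\ldots$ be the Euler constant, and put \[ \zeta^\circ=\sum_{k=1}^\infty\biggl[\biggl(\sum_{s=1}^k e_s\biggr)^{-1}-\frac1k\biggr]+\gamma , \] where the series converges almost surely. Let $\zeta_1^\circ,\ldots,\zeta_p^\circ$ be independent random variables, each with the same distribution as $\zeta^\circ$. Then for any $\lambda_1,\ldots,\lambda_p>0$ with $\sum_{i=1}^p\lambda_i=1$ and every $x\in\mathbb{R}$, \[ \mathbf{P}\Biggl\{\sum_{i=1}^p\lambda_i\zeta_i^\circ+\sum_{i=1}^p\lambda_i\log\lambda_i\le x\Biggr\}=\mathbf{P}\{\zeta^\circ\le x\}. \] -/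

import Mathlib

open MeasureTheory ProbabilityTheory

/-- The `k`-th term (`k = 0, 1, 2, …` standing for `1, 2, 3, …`) of the series defining `ζ°`:
`(e₁ + ⋯ + e_{k+1})⁻¹ - 1 / (k + 1)`, for a sequence `e` of random variables on `Ω`. -/
noncomputable def zetaTerm {Ω : Type*} (e : ℕ → Ω → ℝ) (ω : Ω) (k : ℕ) : ℝ :=
  (∑ s ∈ Finset.range (k + 1), e s ω)⁻¹ - 1 / ((k : ℝ) + 1)

/-- The random variable `ζ° = ∑_{k ≥ 1} [(e₁ + ⋯ + e_k)⁻¹ - 1 / k] + γ` built from the sequence `e`,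
with `γ` the Euler–Mascheroni constant. -/
noncomputable def zetaCirc {Ω : Type*} (e : ℕ → Ω → ℝ) (ω : Ω) : ℝ :=
  (∑' k : ℕ, zetaTerm e ω k) + Real.eulerMascheroniConstant

/-- `e` is a sequence of independent standard (rate one) exponential random variables. -/
structure IsIIDStdExp {Ω : Type*} [MeasurableSpace Ω] (e : ℕ → Ω → ℝ) (P : Measure Ω) : Prop where
  indep : iIndepFun e P
  law : ∀ s, HasLaw (e s) (expMeasure 1) P

/-! The partial sums Γ_k = e_1 + ⋯ + e_k are the points of a rate one Poisson process. Given Γ_{n+1}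
= T, the earlier points are an ordered sample of n uniform points of (0, T). With H_u(T) = ∫_0^T
e^{iu/x} dx, the conditional mean of ∏_{k ≤ n} e^{iu/Γ_k} is therefore (H_u(T)/T)^n
(`integral_prod_expRecip_mul_eq`).

As T → ∞, H_u(T) = T + iu log T + C(u) + o(1). Multiplying by e^{-iu log Γ_{n+1}} and letting n → ∞
turns the product into e^{iuζ°} and the power into e^{C(u)} (`tendsto_expRecipInt_div_pow`), so E
e^{iuζ°} = e^{C(u)}. The second limit needs log n · (Γ_{n+1}/n - 1) → 0, which is proved along n =
4^m only; a subsequence suffices to identify the limit.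

Scaling x by λ gives H_{λu}(λT) = λ H_u(T), hence C(λu) = λ C(u) - iuλ log λ (`expRecipConst_mul`).
When ∑ λ_i = 1, summing gives ∑ C(λ_i u) = C(u) - iu ∑ λ_i log λ_i, and the shift by ∑ λ_i log λ_i
cancels the last term. -/

section

open Set Filter Topology

/-! ### The oscillating function e^{iu/x} and its primitive -/

/-- The function `x ↦ exp (i u / x)`. -/
noncomputable def expRecip (u x : ℝ) : ℂ := Complex.exp (((u / x : ℝ) : ℂ) * Complex.I)

/-- The primitive of `expRecip u` vanishing at `0`. -/
noncomputable def expRecipInt (u T : ℝ) : ℂ := ∫ x in (0 : ℝ)..T, expRecip u x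

lemma norm_expRecip (u x : ℝ) : ‖expRecip u x‖ = 1 := Complex.norm_exp_ofReal_mul_I _

@[fun_prop]
lemma measurable_expRecip (u : ℝ) : Measurable (expRecip u) := by
  unfold expRecip; fun_prop

lemma continuousAt_expRecip (u : ℝ) {x : ℝ} (hx : x ≠ 0) : ContinuousAt (expRecip u) x := by
  unfold expRecip
  have : ContinuousAt (fun x : ℝ => u / x) x := continuousAt_const.div continuousAt_id hx
  fun_prop

lemma intervalIntegrable_expRecip (u a b : ℝ) : IntervalIntegrable (expRecip u) volume a b := by
  refine (intervalIntegrable_const (c := (1 : ℝ))).mono_fun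
    (measurable_expRecip u).aestronglyMeasurable (ae_of_all _ fun x => ?_)
  simp [norm_expRecip]

@[fun_prop]
lemma continuous_expRecipInt (u : ℝ) : Continuous (expRecipInt u) :=
  intervalIntegral.continuous_primitive (intervalIntegrable_expRecip u) 0

lemma norm_expRecipInt_le (u T : ℝ) : ‖expRecipInt u T‖ ≤ |T| := by
  have := intervalIntegral.norm_integral_le_of_norm_le_const (a := 0) (b := T) (C := 1)
    (f := expRecip u) (fun x _ => (norm_expRecip u x).le)
  simpa [expRecipInt] using this

lemma hasDerivAt_expRecipInt (u : ℝ) {x : ℝ} (hx : x ≠ 0) :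
    HasDerivAt (expRecipInt u) (expRecip u x) x :=
  intervalIntegral.integral_hasDerivAt_right (intervalIntegrable_expRecip u 0 x)
    ((measurable_expRecip u).stronglyMeasurable.stronglyMeasurableAtFilter)
    (continuousAt_expRecip u hx)

lemma expRecipInt_zero_left (T : ℝ) : expRecipInt 0 T = T := by
  simp [expRecipInt, expRecip]

lemma intervalIntegrable_expRecip_mul_pow (u : ℝ) (n : ℕ) (a b : ℝ) :
    IntervalIntegrable (fun x => expRecip u x * expRecipInt u x ^ n) volume a b :=
  (intervalIntegrable_expRecip u a b).mul_continuousOn (by fun_prop)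

lemma integral_expRecip_mul_pow (u : ℝ) (n : ℕ) {T : ℝ} (hT : 0 ≤ T) :
    ∫ x in Ioo 0 T, expRecip u x * expRecipInt u x ^ n = expRecipInt u T ^ (n + 1) / (n + 1) := by
  -- For u ≠ 0 the integrand oscillates at 0, so the form of the fundamental theorem used asks for a
  -- derivative on the open interval only.
  have h := intervalIntegral.integral_eq_sub_of_hasDerivAt_of_le hT
    (f := fun x => expRecipInt u x ^ (n + 1) / (n + 1))
    (f' := fun x => expRecip u x * expRecipInt u x ^ n) (by fun_prop)
    (fun x hx => by
      have := ((hasDerivAt_expRecipInt u hx.1.ne').pow (n + 1)).div_const ((n : ℂ) + 1)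
      have h0 : (n : ℂ) + 1 ≠ 0 := by exact_mod_cast n.succ_ne_zero
      convert! this using 1
      push_cast
      field_simp) (intervalIntegrable_expRecip_mul_pow u n 0 T)
  rw [← integral_Ioc_eq_integral_Ioo, ← intervalIntegral.integral_of_le hT, h]
  simp [expRecipInt]

/-! ### Integration against the exponential law -/

lemma expMeasure_one_eq : expMeasure 1 = (volume.restrict (Ioi (0 : ℝ))).withDensity
    (fun x => ENNReal.ofReal (Real.exp (-x))) := by
  rw [← withDensity_indicator measurableSet_Ioi]
  refine withDensity_congr_ae ?_
  have h0 : ∀ᵐ x : ℝ, x ≠ 0 := by simp [ae_iff, measure_singleton]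
  filter_upwards [h0] with x hx
  have := exponentialPDF_eq 1 x
  rw [exponentialPDF, exponentialPDFReal] at this
  rw [gammaPDF, this]
  rcases lt_or_gt_of_ne hx with h | h
  · simp [h.not_ge, h.le, indicator]
  · simp [h.le, h, indicator]

lemma integral_expMeasure_one (g : ℝ → ℂ) :
    ∫ x, g x ∂(expMeasure 1) = ∫ x in Ioi 0, (Real.exp (-x) : ℂ) * g x := by
  rw [expMeasure_one_eq, integral_withDensity_eq_integral_toReal_smul (by fun_prop) (by simp)]
  refine integral_congr_ae (ae_of_all _ fun x => ?_)
  simp [ENNReal.toReal_ofReal (Real.exp_nonneg _)]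

/-- Adding an independent exponential variable, seen on bounded test functions. -/
lemma integral_mul_comp_add_exp {Ω : Type*} [MeasurableSpace Ω] {P : Measure Ω}
    [IsProbabilityMeasure P] {a : Ω → ℂ} {S Y : Ω → ℝ} (ha : Measurable a) (hS : Measurable S)
    (hY : Measurable Y) {C : ℝ} (ha1 : ∀ ω, ‖a ω‖ ≤ 1) (hlaw : HasLaw Y (expMeasure 1) P)
    (hind : IndepFun (fun ω => (a ω, S ω)) Y P) {g : ℝ → ℂ} (hg : Measurable g)
    (hgC : ∀ x, ‖g x‖ ≤ C) :
    ∫ ω, a ω * g (S ω + Y ω) ∂P =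
      ∫ ω, a ω * (∫ y in Ioi (0 : ℝ), (Real.exp (-y) : ℂ) * g (S ω + y)) ∂P := by
  have hX : Measurable fun ω => (a ω, S ω) := ha.prodMk hS
  have hmap := (indepFun_iff_map_prod_eq_prod_map_map hX.aemeasurable hY.aemeasurable).1 hind
  have hprob : IsProbabilityMeasure (expMeasure 1) := isProbabilityMeasure_expMeasure one_pos
  have : IsProbabilityMeasure (P.map fun ω => (a ω, S ω)) :=
    Measure.isProbabilityMeasure_map hX.aemeasurable
  have h1 : ∫ ω, a ω * g (S ω + Y ω) ∂P = ∫ z : (ℂ × ℝ) × ℝ, z.1.1 * g (z.1.2 + z.2)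
      ∂(P.map fun ω => ((a ω, S ω), Y ω)) := by
    rw [integral_map (by fun_prop)]
    exact (by fun_prop : Measurable _).aestronglyMeasurable
  have hint : Integrable (fun z : (ℂ × ℝ) × ℝ => z.1.1 * g (z.1.2 + z.2))
      ((P.map fun ω => (a ω, S ω)).prod (expMeasure 1)) := by
    rw [← hlaw.map_eq, ← hmap, integrable_map_measure
      (by fun_prop : Measurable _).aestronglyMeasurable (by fun_prop)]
    refine Integrable.of_bound (by fun_prop : Measurable _).aestronglyMeasurable C
      (ae_of_all _ fun ω => ?_)
    simp only [Function.comp, norm_mul]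
    calc _ ≤ 1 * C := mul_le_mul (ha1 ω) (hgC _) (norm_nonneg _) zero_le_one
      _ = C := one_mul C
  rw [h1, hmap, hlaw.map_eq, integral_prod _ hint, integral_map hX.aemeasurable
    hint.aestronglyMeasurable.integral_prod_right']
  refine integral_congr_ae (ae_of_all _ fun ω => ?_)
  simp only
  rw [integral_const_mul, integral_expMeasure_one]

/-- This justifies Fubini in `integral_expRecip_mul_tail`. On 0 < x < T the primitive is at most x <
T in norm, so C T^n e^{-T} dominates. -/
lemma integrable_expRecip_triangle (u : ℝ) (n : ℕ) {g : ℝ → ℂ} (hg : Measurable g) {C : ℝ}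
    (hgC : ∀ x, ‖g x‖ ≤ C) :
    Integrable (fun z : ℝ × ℝ => {z : ℝ × ℝ | z.1 < z.2}.indicator (fun z =>
      expRecip u z.1 * expRecipInt u z.1 ^ n * ((Real.exp (-z.2) : ℂ) * g z.2)) z)
      ((volume.restrict (Ioi (0 : ℝ))).prod (volume.restrict (Ioi (0 : ℝ)))) := by
  have hm : Measurable (expRecipInt u) := (continuous_expRecipInt u).measurable
  have hset : MeasurableSet {z : ℝ × ℝ | z.1 < z.2} :=
    measurableSet_lt measurable_fst measurable_snd
  have hC : 0 ≤ C := (norm_nonneg _).trans (hgC 0)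
  have hdom : Integrable (fun z : ℝ × ℝ => {z : ℝ × ℝ | z.1 < z.2}.indicator (fun z =>
      C * (z.2 ^ n * Real.exp (-z.2))) z)
      ((volume.restrict (Ioi (0 : ℝ))).prod (volume.restrict (Ioi (0 : ℝ)))) := by
    have key : ∀ T : ℝ, (fun x => {z : ℝ × ℝ | z.1 < z.2}.indicator (fun z : ℝ × ℝ =>
        C * (z.2 ^ n * Real.exp (-z.2))) (x, T)) =
        (Iio T).indicator (fun _ => C * (T ^ n * Real.exp (-T))) := by
      intro T; ext x; simp [indicator]
    rw [integrable_prod_iff' (by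
      exact ((by fun_prop : Measurable _).indicator hset).aestronglyMeasurable)]
    constructor
    · refine ae_of_all _ fun T => ?_
      rw [key, integrable_indicator_iff measurableSet_Iio, integrableOn_const_iff]
      right
      rw [Measure.restrict_apply measurableSet_Iio]
      exact (measure_mono (show Iio T ∩ Ioi 0 ⊆ Ioo 0 T from fun x hx => ⟨hx.2, hx.1⟩)).trans_lt (by simp)
    -- Integrating over x in (0, T) adds a factor T, so the exponent is n + 1 = s - 1.
    · have h := (Real.GammaIntegral_convergent (s := (n : ℝ) + 2) (by positivity)).const_mul C
      refine (integrableOn_congr_fun ?_ measurableSet_Ioi).1 h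
      intro T hT
      have hT : 0 < T := hT
      have : (fun x => ‖{z : ℝ × ℝ | z.1 < z.2}.indicator (fun z : ℝ × ℝ =>
        C * (z.2 ^ n * Real.exp (-z.2))) (x, T)‖) =
        (Iio T).indicator (fun _ => C * (T ^ n * Real.exp (-T))) := by
        ext x
        rw [congrFun (key T) x, Real.norm_of_nonneg]
        exact indicator_nonneg (fun _ _ => by positivity) _
      simp only [this]
      rw [integral_indicator measurableSet_Iio, Measure.restrict_restrict measurableSet_Iio,
        Iio_inter_Ioi, setIntegral_const]
      have h2 : T ^ ((n : ℝ) + 2 - 1) = T ^ (n + 1) := by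
        rw [← Real.rpow_natCast]; push_cast; ring_nf
      rw [h2]
      simp [Measure.real, hT.le]
      ring
  refine hdom.mono' ?_ ?_
  · exact ((by fun_prop : Measurable _).indicator hset).aestronglyMeasurable
  · have h1 : ∀ᵐ z : ℝ × ℝ ∂((volume.restrict (Ioi (0 : ℝ))).prod
        (volume.restrict (Ioi (0 : ℝ)))), z ∈ Ioi (0 : ℝ) ×ˢ Ioi (0 : ℝ) := by
      rw [Measure.prod_restrict]
      exact ae_restrict_mem (measurableSet_Ioi.prod measurableSet_Ioi)
    filter_upwards [h1] with z hz
    have hz1 : 0 < z.1 := hz.1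
    rw [norm_indicator_eq_indicator_norm]
    refine indicator_le_indicator' fun hlt => ?_
    have hlt : z.1 < z.2 := hlt
    have h2 : ‖expRecipInt u z.1‖ ≤ z.2 :=
      (norm_expRecipInt_le u z.1).trans (by rw [abs_of_pos hz1]; exact hlt.le)
    rw [norm_mul, norm_mul, norm_expRecip, norm_pow, norm_mul, one_mul, Complex.norm_real,
      Real.norm_of_nonneg (Real.exp_nonneg _)]
    calc _ ≤ z.2 ^ n * (Real.exp (-z.2) * C) := by
            have := hgC z.2
            have := hz1.trans hlt
            gcongr
      _ = _ := by ring

/-- Put T = x + y, so that e^{-x} e^{-y} = e^{-T}, and exchange the integrals: the inner one is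
∫_0^T H' H^n with H = `expRecipInt u`. This is the induction step of `integral_prod_expRecip_mul`.
-/
lemma integral_expRecip_mul_tail (u : ℝ) (n : ℕ) {g : ℝ → ℂ} (hg : Measurable g) {C : ℝ}
    (hgC : ∀ x, ‖g x‖ ≤ C) :
    ∫ x in Ioi (0 : ℝ), (Real.exp (-x) : ℂ) * (expRecip u x *
      ∫ y in Ioi (0 : ℝ), (Real.exp (-y) : ℂ) * g (x + y)) * expRecipInt u x ^ n =
    ∫ T in Ioi (0 : ℝ), (Real.exp (-T) : ℂ) * g T * (expRecipInt u T ^ (n + 1) / (n + 1)) := by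
  have hswap := integral_integral_swap (f := fun x T => {z : ℝ × ℝ | z.1 < z.2}.indicator (fun z =>
      expRecip u z.1 * expRecipInt u z.1 ^ n * ((Real.exp (-z.2) : ℂ) * g z.2)) (x, T))
    (integrable_expRecip_triangle u n hg hgC)
  have hL : ∀ x ∈ Ioi (0 : ℝ), (Real.exp (-x) : ℂ) * (expRecip u x *
      ∫ y in Ioi (0 : ℝ), (Real.exp (-y) : ℂ) * g (x + y)) * expRecipInt u x ^ n =
      ∫ T in Ioi (0 : ℝ), {z : ℝ × ℝ | z.1 < z.2}.indicator (fun z =>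
      expRecip u z.1 * expRecipInt u z.1 ^ n * ((Real.exp (-z.2) : ℂ) * g z.2)) (x, T) := by
    intro x hx
    have hx : 0 < x := hx
    have e1 : ∀ T, {z : ℝ × ℝ | z.1 < z.2}.indicator (fun z =>
      expRecip u z.1 * expRecipInt u z.1 ^ n * ((Real.exp (-z.2) : ℂ) * g z.2)) (x, T) =
      (Ioi x).indicator (fun T => expRecip u x * expRecipInt u x ^ n *
        ((Real.exp (-T) : ℂ) * g T)) T := by
      intro T; simp [indicator]
    simp_rw [e1]
    rw [integral_indicator measurableSet_Ioi, Measure.restrict_restrict measurableSet_Ioi,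
      inter_eq_left.2 (Ioi_subset_Ioi hx.le), integral_const_mul]
    have e2 : ∫ T in Ioi x, (Real.exp (-T) : ℂ) * g T =
        ∫ y in Ioi (0 : ℝ), (Real.exp (-(x + y)) : ℂ) * g (x + y) := by
      have := (measurePreserving_add_left volume x).setIntegral_preimage_emb
        (measurableEmbedding_addLeft x) (fun T => (Real.exp (-T) : ℂ) * g T) (Ioi x)
      simpa using this.symm
    have e3 : ∀ y : ℝ, (Real.exp (-(x + y)) : ℂ) * g (x + y) =
        (Real.exp (-x) : ℂ) * ((Real.exp (-y) : ℂ) * g (x + y)) := by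
      intro y
      rw [neg_add, Real.exp_add]; push_cast; ring
    simp_rw [e2, e3]
    rw [integral_const_mul]
    ring
  rw [setIntegral_congr_fun measurableSet_Ioi hL, hswap]
  refine setIntegral_congr_fun measurableSet_Ioi fun T hT => ?_
  have hT : 0 < T := hT
  have e1 : ∀ x, {z : ℝ × ℝ | z.1 < z.2}.indicator (fun z =>
      expRecip u z.1 * expRecipInt u z.1 ^ n * ((Real.exp (-z.2) : ℂ) * g z.2)) (x, T) =
      (Iio T).indicator (fun x => expRecip u x * expRecipInt u x ^ n *
        ((Real.exp (-T) : ℂ) * g T)) x := by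
    intro x; simp [indicator]
  simp_rw [e1]
  rw [integral_indicator measurableSet_Iio, Measure.restrict_restrict measurableSet_Iio,
    Iio_inter_Ioi, integral_mul_const, integral_expRecip_mul_pow u n hT.le]
  ring

/-! ### The joint law of the partial sums -/

/-- The partial sums of a sequence of random variables, the `n`-th one having `n + 1` terms. -/
def arrival {Ω : Type*} (e : ℕ → Ω → ℝ) (n : ℕ) (ω : Ω) : ℝ := ∑ s ∈ Finset.range (n + 1), e s ω

lemma measurable_arrival {Ω : Type*} [MeasurableSpace Ω] {e : ℕ → Ω → ℝ}
    (hm : ∀ s, Measurable (e s)) (n : ℕ) : Measurable (arrival e n) :=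
  Finset.measurable_fun_sum _ fun s _ => hm s

lemma arrival_succ {Ω : Type*} (e : ℕ → Ω → ℝ) (n : ℕ) (ω : Ω) :
    arrival e (n + 1) ω = arrival e n ω + e (n + 1) ω := Finset.sum_range_succ _ _

section Arrival

variable {Ω : Type*} [MeasurableSpace Ω] {P : Measure Ω} {e : ℕ → Ω → ℝ}

/-- Both components are measurable for the natural filtration at time n, of which the next variable
is independent. -/
lemma indepFun_prod_expRecip_arrival (he : IsIIDStdExp e P) (hm : ∀ s, Measurable (e s))
    (u : ℝ) (n : ℕ) :
    IndepFun (fun ω => (∏ k ∈ Finset.range (n + 1), expRecip u (arrival e k ω), arrival e n ω))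
      (e (n + 1)) P := by
  have hi := he.indep.indep_comap_natural_of_lt (fun s => (hm s).stronglyMeasurable)
    (Nat.lt_succ_self n)
  rw [IndepFun_iff_Indep]
  refine indep_of_indep_of_le_left hi.symm ?_
  rw [← measurable_iff_comap_le]
  set F := Filtration.natural e (fun s => (hm s).stronglyMeasurable)
  have h1 : ∀ k ≤ n, Measurable[F n] (arrival e k) := by
    intro k hk
    refine Finset.measurable_fun_sum _ fun s hs => ?_
    have hs' : s ≤ n := by have := Finset.mem_range.1 hs; omega
    exact ((Filtration.stronglyAdapted_natural (fun s => (hm s).stronglyMeasurable) s).measurable).mono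
      (F.mono hs') le_rfl
  refine Measurable.prodMk ?_ (h1 n le_rfl)
  refine Finset.measurable_fun_prod _ fun k hk => ?_
  exact (measurable_expRecip u).comp (h1 k (by have := Finset.mem_range.1 hk; omega))

/-- The simplex 0 < x_1 < ⋯ < x_n < T has volume T^n / n!; weighting each coordinate by e^{iu/x}
replaces T by the primitive. The induction integrates out the last exponential variable. -/
theorem integral_prod_expRecip_mul [IsProbabilityMeasure P] (he : IsIIDStdExp e P) (hm : ∀ s, Measurable (e s)) (u : ℝ)
    (n : ℕ) : ∀ {g : ℝ → ℂ} (_ : Measurable g) {C : ℝ} (_ : ∀ x, ‖g x‖ ≤ C),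
    ∫ ω, (∏ k ∈ Finset.range n, expRecip u (arrival e k ω)) * g (arrival e n ω) ∂P =
      ∫ T in Ioi (0 : ℝ), (Real.exp (-T) : ℂ) * g T * (expRecipInt u T ^ n / n.factorial) := by
  induction n with
  | zero =>
    intro g hg C hgC
    have h := (he.law 0).integral_comp (f := g) hg.aestronglyMeasurable
    simp only [Function.comp_def] at h
    simp [arrival, h, integral_expMeasure_one]
  | succ n ih =>
    intro g hg C hgC
    have hC : 0 ≤ C := (norm_nonneg _).trans (hgC 0)
    simp_rw [arrival_succ]
    have hA : ∀ k, Measurable (arrival e k) := measurable_arrival hm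
    rw [integral_mul_comp_add_exp (by fun_prop) (by fun_prop) (hm _)
      (fun ω => by simp [norm_expRecip]) (he.law (n + 1))
      (indepFun_prod_expRecip_arrival he hm u n) hg hgC]
    have hgt : Measurable fun x => ∫ y in Ioi (0 : ℝ), (Real.exp (-y) : ℂ) * g (x + y) := by
      have : StronglyMeasurable fun x => ∫ y in Ioi (0 : ℝ), (Real.exp (-y) : ℂ) * g (x + y) :=
        StronglyMeasurable.integral_prod_right
          (f := fun x y => (Real.exp (-y) : ℂ) * g (x + y))
          (by exact (by fun_prop : Measurable _).stronglyMeasurable)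
      exact this.measurable
    have hb : ∀ x, ‖expRecip u x * ∫ y in Ioi (0 : ℝ), (Real.exp (-y) : ℂ) * g (x + y)‖ ≤ C := by
      intro x
      rw [norm_mul, norm_expRecip, one_mul, ← integral_expMeasure_one (fun y => g (x + y))]
      have hprob : IsProbabilityMeasure (expMeasure 1) := isProbabilityMeasure_expMeasure one_pos
      simpa using norm_integral_le_of_norm_le_const (μ := expMeasure 1)
        (ae_of_all _ fun y => hgC (x + y))
    -- The new test function absorbs the last factor of the product and the mean over the last
    -- variable.
    have := ih (g := fun x => expRecip u x *
      ∫ y in Ioi (0 : ℝ), (Real.exp (-y) : ℂ) * g (x + y)) (by fun_prop) hb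
    simp_rw [Finset.prod_range_succ, mul_assoc]
    simp only [mul_assoc] at this
    rw [this]
    have h2 := integral_expRecip_mul_tail u n hg hgC
    have e1 : ∀ x : ℝ, (Real.exp (-x) : ℂ) * (expRecip u x *
      ((∫ y in Ioi (0 : ℝ), (Real.exp (-y) : ℂ) * g (x + y)) *
        (expRecipInt u x ^ n / n.factorial))) = ((Real.exp (-x) : ℂ) * (expRecip u x *
      ∫ y in Ioi (0 : ℝ), (Real.exp (-y) : ℂ) * g (x + y)) * expRecipInt u x ^ n) *
      (n.factorial : ℂ)⁻¹ := by intro x; ring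
    simp_rw [e1]
    rw [integral_mul_const, h2, ← integral_mul_const]
    congr 1; ext T
    rw [Nat.factorial_succ]; push_cast
    have : (n : ℂ) + 1 ≠ 0 := by exact_mod_cast n.succ_ne_zero
    field_simp

theorem integral_prod_expRecip_mul_eq [IsProbabilityMeasure P] (he : IsIIDStdExp e P) (hm : ∀ s, Measurable (e s)) (u : ℝ)
    (n : ℕ) {g : ℝ → ℂ} (hg : Measurable g) {C : ℝ} (hgC : ∀ x, ‖g x‖ ≤ C) :
    ∫ ω, (∏ k ∈ Finset.range n, expRecip u (arrival e k ω)) * g (arrival e n ω) ∂P =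
      ∫ ω, (expRecipInt u (arrival e n ω) / arrival e n ω) ^ n * g (arrival e n ω) ∂P := by
  have hC : 0 ≤ C := (norm_nonneg _).trans (hgC 0)
  have hm' : Measurable (expRecipInt u) := (continuous_expRecipInt u).measurable
  -- At u = 0 the product is 1 and the primitive is T: this is the Gamma density of `arrival e n`,
  -- and converts the integral over T back to an expectation.
  have h0 := integral_prod_expRecip_mul he hm 0 n
    (g := fun T => (expRecipInt u T / T) ^ n * g T) (by fun_prop) (C := C) (fun x => by
      rw [norm_mul, norm_pow, norm_div, Complex.norm_real, Real.norm_eq_abs]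
      have h1 : ‖expRecipInt u x‖ / |x| ≤ 1 :=
        div_le_one_of_le₀ (norm_expRecipInt_le u x) (abs_nonneg x)
      calc _ ≤ 1 * C := mul_le_mul (pow_le_one₀ (by positivity) h1) (hgC x) (norm_nonneg _)
            zero_le_one
        _ = C := one_mul C)
  have e0 : ∀ x, expRecip 0 x = 1 := by simp [expRecip]
  simp only [e0, Finset.prod_const_one, one_mul, expRecipInt_zero_left] at h0
  rw [h0, integral_prod_expRecip_mul he hm u n hg hgC]
  refine setIntegral_congr_fun measurableSet_Ioi fun T hT => ?_
  have : (T : ℂ) ≠ 0 := by exact_mod_cast (ne_of_gt hT : T ≠ 0)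
  simp only [div_pow]
  field_simp

end Arrival

/-! ### Asymptotics of the primitive and scaling of its constant term -/

lemma norm_exp_mul_I_sub_le (y : ℝ) :
    ‖Complex.exp (y * Complex.I) - 1 - y * Complex.I‖ ≤ 3 * y ^ 2 := by
  have hn : ‖(y : ℂ) * Complex.I‖ = |y| := by simp
  rcases le_total |y| 1 with h | h
  · have := Complex.norm_exp_sub_one_sub_id_le (x := y * Complex.I) (by rwa [hn])
    rw [hn, sq_abs] at this
    nlinarith [sq_nonneg y]
  · calc _ ≤ ‖Complex.exp (y * Complex.I)‖ + ‖(1 : ℂ)‖ + ‖(y : ℂ) * Complex.I‖ :=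
          (norm_sub_le _ _).trans (add_le_add_left (norm_sub_le _ _) _)
      _ = 2 + |y| := by rw [Complex.norm_exp_ofReal_mul_I, hn, norm_one]; ring
      _ ≤ _ := by rw [← sq_abs]; nlinarith

/-- `expRecipInt u T` with its asymptotic expansion `T + i u log T` removed. -/
noncomputable def expRecipRem (u T : ℝ) : ℂ :=
  expRecipInt u T - T - ((u * Real.log T : ℝ) : ℂ) * Complex.I

/-- The function e^{iu/x} - 1 - iu/x is O(x^{-2}), hence integrable on (1, ∞); the subtracted terms
integrate to T - 1 and iu log T. -/
lemma exists_tendsto_expRecipRem (u : ℝ) : ∃ c, Tendsto (expRecipRem u) atTop (𝓝 c) := by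
  set f : ℝ → ℂ := fun x => expRecip u x - 1 - ((u / x : ℝ) : ℂ) * Complex.I with hf
  have hfm : Measurable f := by fun_prop
  have hfi : IntegrableOn f (Ioi 1) := by
    have hd : IntegrableOn (fun x : ℝ => 3 * u ^ 2 * x ^ (-2 : ℝ)) (Ioi 1) :=
      (integrableOn_Ioi_rpow_of_lt (by norm_num) one_pos).const_mul _
    refine hd.mono' hfm.aestronglyMeasurable ?_
    filter_upwards [ae_restrict_mem measurableSet_Ioi] with x hx
    have hx : 1 < x := hx
    refine (norm_exp_mul_I_sub_le (u / x)).trans_eq ?_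
    rw [Real.rpow_neg (by linarith), div_pow, mul_div_assoc', div_eq_mul_inv]
    norm_cast
  have hlim := intervalIntegral_tendsto_integral_Ioi 1 hfi tendsto_id
  refine ⟨(∫ x in Ioi 1, f x) + (expRecipInt u 1 - 1), ?_⟩
  refine (hlim.add_const _).congr' ?_
  filter_upwards [eventually_ge_atTop 1] with T hT
  have hT0 : 0 < T := by linarith
  have hne : ∀ x ∈ uIcc 1 T, x ≠ 0 := by
    intro x hx
    rw [uIcc_of_le hT] at hx
    linarith [hx.1]
  have hi2 : IntervalIntegrable (fun x : ℝ => ((u / x : ℝ) : ℂ) * Complex.I) volume 1 T := by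
    refine ContinuousOn.intervalIntegrable fun x hx => ?_
    have : ContinuousAt (fun x : ℝ => u / x) x := continuousAt_const.div continuousAt_id (hne x hx)
    exact ContinuousAt.continuousWithinAt (by fun_prop)
  have e2 : ∫ x in (1 : ℝ)..T, ((u / x : ℝ) : ℂ) * Complex.I =
      ((u * Real.log T : ℝ) : ℂ) * Complex.I := by
    rw [intervalIntegral.integral_mul_const, intervalIntegral.integral_ofReal]
    simp_rw [div_eq_mul_inv]
    rw [intervalIntegral.integral_const_mul, integral_inv_of_pos one_pos hT0, div_one]
  have e1 : ∫ x in (1 : ℝ)..T, expRecip u x = expRecipInt u T - expRecipInt u 1 :=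
    (intervalIntegral.integral_interval_sub_left (intervalIntegrable_expRecip u 0 T)
      (intervalIntegrable_expRecip u 0 1)).symm
  simp only [id, hf]
  rw [intervalIntegral.integral_sub ((intervalIntegrable_expRecip u 1 T).sub (by simp)) hi2,
    intervalIntegral.integral_sub (intervalIntegrable_expRecip u 1 T) (by simp), e1, e2,
    intervalIntegral.integral_const, expRecipRem]
  simp
  ring

/-- The constant term in the expansion of `expRecipInt u T` as `T → ∞`. -/
noncomputable def expRecipConst (u : ℝ) : ℂ := (exists_tendsto_expRecipRem u).choose

lemma tendsto_expRecipRem (u : ℝ) : Tendsto (expRecipRem u) atTop (𝓝 (expRecipConst u)) :=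
  (exists_tendsto_expRecipRem u).choose_spec

lemma expRecipInt_mul (u T : ℝ) {l : ℝ} (hl : 0 < l) :
    expRecipInt (l * u) (l * T) = l * expRecipInt u T := by
  have h := intervalIntegral.integral_comp_mul_left (a := 0) (b := T) (expRecip (l * u)) hl.ne'
  have e : ∀ x, expRecip (l * u) (l * x) = expRecip u x := by
    intro x; rw [expRecip, mul_div_mul_left _ _ hl.ne', expRecip]
  simp only [e, mul_zero] at h
  rw [expRecipInt, expRecipInt, h, Complex.real_smul, ← mul_assoc, ← Complex.ofReal_mul,
    mul_inv_cancel₀ hl.ne', Complex.ofReal_one, one_mul]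

/-- Compare the expansions of both sides of `expRecipInt_mul` as T → ∞; the correction comes from
log(lT) = log l + log T. -/
lemma expRecipConst_mul (u : ℝ) {l : ℝ} (hl : 0 < l) :
    expRecipConst (l * u) =
      l * expRecipConst u - ((u * (l * Real.log l) : ℝ) : ℂ) * Complex.I := by
  refine tendsto_nhds_unique
    ((tendsto_expRecipRem (l * u)).comp (tendsto_id.const_mul_atTop hl)) ?_
  refine (((tendsto_expRecipRem u).const_mul (l : ℂ)).sub_const _).congr' ?_
  filter_upwards [eventually_gt_atTop 0] with T hT
  simp only [Function.comp, id, expRecipRem]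
  rw [expRecipInt_mul u T hl, Real.log_mul hl.ne' hT.ne']
  push_cast
  ring

/-! ### Limits of large powers -/

lemma tendsto_one_add_pow_exp_of_tendsto_mul {ι : Type*} {l : Filter ι} {N : ι → ℕ} {z : ι → ℂ}
    {t : ℂ} (hz : Tendsto z l (𝓝 0)) (h : Tendsto (fun i => (N i : ℂ) * z i) l (𝓝 t)) :
    Tendsto (fun i => (1 + z i) ^ N i) l (𝓝 (Complex.exp t)) := by
  have h1 : (fun i => Complex.log (1 + z i) - z i) =O[l] fun i => z i ^ 2 :=
    Complex.log_sub_self_isBigO.comp_tendsto hz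
  have h2 : Tendsto (fun i => (N i : ℂ) * (Complex.log (1 + z i) - z i)) l (𝓝 0) := by
    refine ((Asymptotics.isBigO_refl (fun i => (N i : ℂ)) l).mul h1).trans_tendsto ?_
    have := h.mul hz
    rw [mul_zero] at this
    exact this.congr fun i => by ring
  have h3 : Tendsto (fun i => (N i : ℂ) * Complex.log (1 + z i)) l (𝓝 t) := by
    have := h.add h2
    rw [add_zero] at this
    exact this.congr fun i => by ring
  refine (h3.cexp).congr' ?_
  filter_upwards [hz.eventually_ne (show (0 : ℂ) ≠ -1 by simp)] with i hi
  rw [Complex.exp_nat_mul, Complex.exp_log]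
  intro h0
  exact hi (by linear_combination h0)

/-- Write the expression as ((1 + z) e^{-w})^N with z = (iu log T + c)/T and w = iu (log T)/N. Then
N(z - w) = iu log T (N/T - 1) + c N/T, which tends to C(u) thanks to `hlog`; the remaining terms are
of order (log T)²/T or smaller. -/
lemma tendsto_expRecipInt_div_pow (u : ℝ) {ι : Type*} {l : Filter ι} {N : ι → ℕ} {T : ι → ℝ}
    (hN : Tendsto N l atTop) (hT : Tendsto (fun i => T i / N i) l (𝓝 1))
    (hlog : Tendsto (fun i => Real.log (N i) * (T i / N i - 1)) l (𝓝 0)) :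
    Tendsto (fun i => (expRecipInt u (T i) / T i) ^ N i *
      Complex.exp (-((u * Real.log (T i) : ℝ) : ℂ) * Complex.I)) l
      (𝓝 (Complex.exp (expRecipConst u))) := by
  have hNR : Tendsto (fun i => (N i : ℝ)) l atTop := tendsto_natCast_atTop_atTop.comp hN
  have hN0 : ∀ᶠ i in l, (N i : ℝ) ≠ 0 := hNR.eventually_ne_atTop 0
  have hTtop : Tendsto T l atTop := by
    refine (Tendsto.pos_mul_atTop one_pos hT hNR).congr' ?_
    filter_upwards [hN0] with i hi
    field_simp
  have hT0 : ∀ᶠ i in l, 0 < T i := hTtop.eventually_gt_atTop 0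
  have hNT : Tendsto (fun i => N i / T i) l (𝓝 1) := by
    simpa using hT.inv₀ one_ne_zero
  have hlogr : Tendsto (fun i => Real.log (T i / N i)) l (𝓝 0) := by
    simpa using hT.log one_ne_zero
  -- Split log T = log N + log(T/N).
  have hL : Tendsto (fun i => Real.log (T i) * (N i / T i - 1)) l (𝓝 0) := by
    have h1 := (hlog.mul hNT).neg
    have h2 := hlogr.mul (hNT.sub_const 1)
    have h3 := h1.add h2
    simp only [zero_mul, neg_zero, add_zero] at h3
    refine h3.congr' ?_
    filter_upwards [hN0, hT0] with i hi ht
    rw [Real.log_div ht.ne' hi]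
    field_simp
    ring
  have hL2 : Tendsto (fun i => Real.log (T i) ^ 2 / T i) l (𝓝 0) := by
    have := (Real.isLittleO_pow_log_id_atTop (n := 2)).tendsto_div_nhds_zero
    exact this.comp hTtop
  have hL1 : Tendsto (fun i => Real.log (T i) / T i) l (𝓝 0) := by
    have := (Real.isLittleO_log_id_atTop).tendsto_div_nhds_zero
    exact this.comp hTtop
  have hc := (tendsto_expRecipRem u).comp hTtop
  set c : ι → ℂ := fun i => expRecipRem u (T i) with hcdef
  have hTinv : Tendsto (fun i => (T i)⁻¹) l (𝓝 0) := tendsto_inv_atTop_zero.comp hTtop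
  set z : ι → ℂ := fun i => ((Real.log (T i) / T i : ℝ) : ℂ) * (u * Complex.I) +
    ((T i)⁻¹ : ℝ) * c i with hz
  set w : ι → ℂ := fun i => ((u * (Real.log (T i) / N i) : ℝ) : ℂ) * Complex.I with hw
  have hzt : Tendsto z l (𝓝 0) := by
    have := (hL1.ofReal.mul_const (u * Complex.I)).add (hTinv.ofReal.mul hc)
    simpa [hz, hcdef] using this
  have hLN : Tendsto (fun i => Real.log (T i) / N i) l (𝓝 0) := by
    have := hL1.mul hT
    rw [zero_mul] at this
    refine this.congr' ?_
    filter_upwards [hT0] with i ht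
    field_simp
  have hwt : Tendsto w l (𝓝 0) := by
    have := ((hLN.const_mul u).ofReal).mul_const Complex.I
    simpa [hw] using this
  set r : ι → ℂ := fun i => Complex.exp (-w i) - 1 + w i with hr
  have hrt : Tendsto (fun i => (N i : ℂ) * r i) l (𝓝 0) := by
    have hb : Tendsto (fun i => 3 * u ^ 2 * (Real.log (T i) ^ 2 / T i * (T i / N i))) l (𝓝 0) := by
      have := (hL2.mul hT).const_mul (3 * u ^ 2)
      simpa using this
    refine squeeze_zero_norm' ?_ hb
    filter_upwards [hN0, hT0] with i hi ht
    have h1 := norm_exp_mul_I_sub_le (-(u * (Real.log (T i) / N i)))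
    have h2 : r i = Complex.exp ((-(u * (Real.log (T i) / N i)) : ℝ) * Complex.I) - 1 -
        (-(u * (Real.log (T i) / N i)) : ℝ) * Complex.I := by
      simp only [hr, hw]; push_cast; ring_nf
    rw [norm_mul, h2, Complex.norm_natCast]
    calc _ ≤ (N i : ℝ) * (3 * (-(u * (Real.log (T i) / N i))) ^ 2) := by gcongr
      _ = _ := by field_simp
  have hg : Tendsto (fun i => (1 + z i) * Complex.exp (-w i) - 1) l (𝓝 0) := by
    have := ((hzt.const_add 1).mul hwt.neg.cexp).sub_const 1
    simpa using this
  -- Since e^{-w} = 1 - w + r, the expression is N(z - w) - N z w + (1 + z) N r; these are `a1`,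
  -- `a2` times iu, and `a3`.
  have hNg : Tendsto (fun i => (N i : ℂ) * ((1 + z i) * Complex.exp (-w i) - 1)) l
      (𝓝 (expRecipConst u)) := by
    have a1 := (hL.ofReal.mul_const (u * Complex.I)).add (hNT.ofReal.mul hc)
    have a2 : Tendsto (fun i => ((Real.log (T i) ^ 2 / T i : ℝ) : ℂ) * (u * Complex.I) +
        ((Real.log (T i) / T i : ℝ) : ℂ) * c i) l (𝓝 0) := by
      have := (hL2.ofReal.mul_const (u * Complex.I)).add (hL1.ofReal.mul hc)
      simpa using this
    have a3 := (hzt.const_add 1).mul hrt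
    have a4 := (a1.sub (a2.mul_const (u * Complex.I))).add a3
    simp only [Complex.ofReal_zero, Complex.ofReal_one, zero_mul, one_mul, zero_add, mul_zero,
      add_zero, sub_zero] at a4
    refine a4.congr' ?_
    filter_upwards [hN0, hT0] with i hi ht
    have hi' : (N i : ℂ) ≠ 0 := by exact_mod_cast hi
    have ht' : (T i : ℂ) ≠ 0 := by exact_mod_cast ht.ne'
    simp only [hr, hz, hw, Function.comp]
    push_cast
    field_simp
    ring
  refine (tendsto_one_add_pow_exp_of_tendsto_mul hg hNg).congr' ?_
  filter_upwards [hN0, hT0] with i hi ht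
  have hi' : (N i : ℂ) ≠ 0 := by exact_mod_cast hi
  have ht' : (T i : ℂ) ≠ 0 := by exact_mod_cast ht.ne'
  have e1 : expRecipInt u (T i) / T i = 1 + z i := by
    simp only [hz, hcdef, expRecipRem]
    push_cast
    field_simp
    ring
  rw [e1, add_sub_cancel, mul_pow, ← Complex.exp_nat_mul]
  congr 2
  simp only [hw]
  push_cast
  field_simp

/-! ### Almost sure behaviour of the partial sums -/

lemma memLp_two_id_expMeasure_one : MemLp id 2 (expMeasure 1) := by
  rw [memLp_two_iff_integrable_sq measurable_id.aestronglyMeasurable, expMeasure_one_eq,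
    integrable_withDensity_iff_integrable_smul' (by fun_prop) (by simp)]
  have h := Real.GammaIntegral_convergent (s := 3) (by norm_num)
  refine h.congr ((ae_restrict_iff' measurableSet_Ioi).2 (ae_of_all _ fun x _ => ?_))
  simp only [id, ENNReal.toReal_ofReal (Real.exp_nonneg _), smul_eq_mul]
  norm_num

lemma integral_id_expMeasure_one : ∫ x, x ∂(expMeasure 1) = 1 := by
  rw [expMeasure_one_eq, integral_withDensity_eq_integral_toReal_smul (by fun_prop) (by simp)]
  have h := Real.Gamma_eq_integral (s := 2) (by norm_num)
  rw [Real.Gamma_two] at h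
  rw [h]
  refine integral_congr_ae (ae_of_all _ fun x => ?_)
  simp only [ENNReal.toReal_ofReal (Real.exp_nonneg _), smul_eq_mul]
  norm_num

lemma ae_pos_expMeasure_one : ∀ᵐ x ∂(expMeasure 1), 0 < x := by
  rw [expMeasure_one_eq]
  exact (withDensity_absolutelyContinuous _ _).ae_le (ae_restrict_mem measurableSet_Ioi)

/-- By Tonelli the sum has finite expectation, hence is almost surely finite. -/
lemma ae_summable_of_integral_le {Ω : Type*} [MeasurableSpace Ω] {P : Measure Ω}
    {f : ℕ → Ω → ℝ} (hi : ∀ n, Integrable (f n) P) (h0 : ∀ n ω, 0 ≤ f n ω) {b : ℕ → ℝ}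
    (hb : Summable b) (h : ∀ n, ∫ ω, f n ω ∂P ≤ b n) : ∀ᵐ ω ∂P, Summable fun n => f n ω := by
  have h1 : ∫⁻ ω, ∑' n, ENNReal.ofReal (f n ω) ∂P ≠ ⊤ := by
    rw [lintegral_tsum fun n => (hi n).aemeasurable.ennreal_ofReal]
    have : ∀ n, ∫⁻ ω, ENNReal.ofReal (f n ω) ∂P ≤ ENNReal.ofReal (b n) := by
      intro n
      rw [← ofReal_integral_eq_lintegral_ofReal (hi n) (ae_of_all _ (h0 n))]
      exact ENNReal.ofReal_le_ofReal (h n)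
    exact ne_top_of_le_ne_top hb.tsum_ofReal_ne_top (ENNReal.tsum_le_tsum this)
  filter_upwards [ae_lt_top' (AEMeasurable.tsum fun n =>
    (hi n).aemeasurable.ennreal_ofReal) h1] with ω hω
  have := ENNReal.summable_toReal hω.ne
  simpa [ENNReal.toReal_ofReal, h0] using this

variable {Ω : Type*} [MeasurableSpace Ω] {P : Measure Ω} {e : ℕ → Ω → ℝ}

lemma IsIIDStdExp.memLp_two (he : IsIIDStdExp e P) (s : ℕ) : MemLp (e s) 2 P := by
  have h := memLp_two_id_expMeasure_one
  rw [← (he.law s).map_eq] at h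
  exact h.comp_of_map (he.law s).aemeasurable

lemma IsIIDStdExp.integral_eq_one (he : IsIIDStdExp e P) (s : ℕ) : ∫ ω, e s ω ∂P = 1 :=
  (he.law s).integral_eq.trans integral_id_expMeasure_one

lemma IsIIDStdExp.ae_arrival_pos (he : IsIIDStdExp e P) : ∀ᵐ ω ∂P, ∀ n, 0 < arrival e n ω := by
  have h : ∀ᵐ ω ∂P, ∀ s, 0 < e s ω := by
    refine ae_all_iff.2 fun s => ?_
    exact ((he.law s).ae_iff (p := fun x => 0 < x) (by fun_prop)).2 ae_pos_expMeasure_one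
  filter_upwards [h] with ω hω n
  exact Finset.sum_pos (fun s _ => hω s) ⟨0, by simp⟩

lemma IsIIDStdExp.ae_tendsto_arrival_div (he : IsIIDStdExp e P) :
    ∀ᵐ ω ∂P, Tendsto (fun n : ℕ => arrival e n ω / n) atTop (𝓝 1) := by
  have := he.indep.isProbabilityMeasure
  have h := strong_law_ae_real e ((he.memLp_two 0).integrable (by norm_num))
    (fun i j hij => he.indep.indepFun hij)
    (fun i => (he.law i).identDistrib (he.law 0))
  rw [he.integral_eq_one 0] at h
  filter_upwards [h] with ω hω
  have h1 := (tendsto_add_atTop_iff_nat 1).2 hω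
  have h2 : Tendsto (fun n : ℕ => ((n : ℝ) + 1) / n) atTop (𝓝 1) := by
    have := (tendsto_inv_atTop_nhds_zero_nat (𝕜 := ℝ)).const_add 1
    rw [add_zero] at this
    refine this.congr' ?_
    filter_upwards [eventually_ne_atTop 0] with n hn
    field_simp
  have h3 := h1.mul h2
  rw [one_mul] at h3
  refine h3.congr fun n => ?_
  rw [arrival]
  push_cast
  field_simp

lemma IsIIDStdExp.memLp_two_arrival (he : IsIIDStdExp e P) (n : ℕ) : MemLp (arrival e n) 2 P :=
  memLp_finsetSum _ fun s _ => he.memLp_two s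

lemma IsIIDStdExp.integral_abs_arrival_sub_le (he : IsIIDStdExp e P) (n : ℕ) :
    ∫ ω, |arrival e n ω - (n + 1)| ∂P ≤ (variance (e 0) P + 1) * √(n + 1) := by
  have := he.indep.isProbabilityMeasure
  have hm := he.memLp_two_arrival n
  have hE : ∫ ω, arrival e n ω ∂P = n + 1 := by
    unfold arrival
    rw [integral_finsetSum _ fun s _ => (he.memLp_two s).integrable (by norm_num)]
    simp [he.integral_eq_one]
  have hV : variance (arrival e n) P = (n + 1) * variance (e 0) P := by
    have h1 : arrival e n = ∑ s ∈ Finset.range (n + 1), e s := by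
      ext ω; simp [arrival]
    rw [h1, IndepFun.variance_sum (fun s _ => he.memLp_two s)
      (fun i _ j _ hij => he.indep.indepFun hij),
      Finset.sum_congr rfl fun s _ => ((he.law s).identDistrib (he.law 0)).variance_eq]
    simp
  have hsq : ∫ ω, (arrival e n ω - (n + 1)) ^ 2 ∂P = (n + 1) * variance (e 0) P := by
    rw [← hV, variance_eq_integral hm.aemeasurable, hE]
  have hm2 : MemLp (fun ω => arrival e n ω - (n + 1)) 2 P := hm.sub (memLp_const _)
  have hr : 0 < √((n : ℝ) + 1) := by positivity
  have hr2 : √((n : ℝ) + 1) ^ 2 = n + 1 := Real.sq_sqrt (by positivity)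
  set r := √((n : ℝ) + 1)
  have hint : Integrable (fun ω => (arrival e n ω - (n + 1)) ^ 2 / r + r) P :=
    (hm2.integrable_sq.div_const _).add (integrable_const _)
  -- Use |y| ≤ y²/r + r with r = √(n + 1), the order of the standard deviation.
  calc ∫ ω, |arrival e n ω - (n + 1)| ∂P
      ≤ ∫ ω, ((arrival e n ω - (n + 1)) ^ 2 / r + r) ∂P := by
        refine integral_mono (hm2.integrable (by norm_num)).abs hint fun ω => ?_
        simp only
        rw [← sq_abs]
        generalize |arrival e n ω - (n + 1)| = y
        rw [div_add' _ _ _ hr.ne', le_div_iff₀ hr]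
        nlinarith [sq_nonneg (y - r), sq_nonneg (y + r), sq_nonneg y, sq_nonneg r]
    _ = (variance (e 0) P + 1) * r := by
        rw [integral_add (hm2.integrable_sq.div_const _) (integrable_const _), integral_div, hsq,
          ← hr2]
        simp
        field_simp

lemma IsIIDStdExp.integrable_abs_arrival_sub (he : IsIIDStdExp e P) (n : ℕ) :
    Integrable (fun ω => |arrival e n ω - (n + 1)|) P := by
  have := he.indep.isProbabilityMeasure
  exact (((he.memLp_two_arrival n).integrable (by norm_num)).sub (integrable_const _)).abs

/-- With Γ = `arrival e n`, the term is -(Γ - (n+1)) / (Γ (n+1)). As Γ grows linearly, it is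
controlled by |Γ - (n+1)| / (n+1)², whose mean is O((n+1)^{-3/2}). -/
theorem IsIIDStdExp.ae_summable_zetaTerm (he : IsIIDStdExp e P) :
    ∀ᵐ ω ∂P, Summable (zetaTerm e ω) := by
  have hsum : ∀ᵐ ω ∂P, Summable fun n : ℕ =>
      |arrival e n ω - (n + 1)| / ((n : ℝ) + 1) ^ 2 := by
    refine ae_summable_of_integral_le (b := fun n : ℕ =>
      (variance (e 0) P + 1) * (1 / ((n : ℝ) + 1) ^ (3 / 2 : ℝ)))
      (fun n => (he.integrable_abs_arrival_sub n).div_const _) (fun n ω => by positivity) ?_ ?_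
    · refine Summable.mul_left _ ?_
      have := (summable_nat_add_iff 1).2
        (Real.summable_one_div_nat_rpow (p := 3 / 2).2 (by norm_num))
      simpa using this
    · intro n
      rw [integral_div, div_le_iff₀ (by positivity)]
      refine (he.integral_abs_arrival_sub_le n).trans_eq ?_
      rw [mul_assoc]
      congr 1
      rw [Real.sqrt_eq_rpow, ← Real.rpow_natCast ((n : ℝ) + 1) 2, one_div_mul_eq_div,
        ← Real.rpow_sub (by positivity)]
      norm_num
  filter_upwards [hsum, he.ae_tendsto_arrival_div, he.ae_arrival_pos] with ω h1 h2 h3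
  -- The factor 4 comes from Γ > n/2 ≥ (n+1)/4, valid for large n ≥ 1.
  refine Summable.of_norm_bounded_eventually_nat (h1.mul_left 4) ?_
  filter_upwards [h2.eventually (lt_mem_nhds (show (1 / 2 : ℝ) < 1 by norm_num)),
    eventually_ge_atTop 1] with n hn hn1
  have hn1' : (1 : ℝ) ≤ n := by exact_mod_cast hn1
  rw [lt_div_iff₀ (by positivity)] at hn
  have hp := h3 n
  have e1 : zetaTerm e ω n = -(arrival e n ω - (n + 1)) / (arrival e n ω * (n + 1)) := by
    have : ∑ s ∈ Finset.range (n + 1), e s ω = arrival e n ω := rfl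
    rw [zetaTerm, this]
    field_simp
    ring
  rw [e1, norm_div, norm_neg, Real.norm_eq_abs, Real.norm_of_nonneg (by positivity),
    div_le_iff₀ (by positivity), mul_assoc]
  have h4 : 1 ≤ 4 * (arrival e n ω * (n + 1)) / ((n : ℝ) + 1) ^ 2 := by
    rw [le_div_iff₀ (by positivity)]
    nlinarith
  calc _ ≤ |arrival e n ω - (n + 1)| * (4 * (arrival e n ω * (n + 1)) / ((n : ℝ) + 1) ^ 2) :=
        le_mul_of_one_le_right (abs_nonneg _) h4
    _ = _ := by ring

/-- Along N = 4^m the mean of log N · |Γ - (N+1)| / N is O(m 2^{-m}), which is summable, so the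
terms tend to 0 almost surely. -/
theorem IsIIDStdExp.ae_tendsto_log_mul (he : IsIIDStdExp e P) {N : ℕ → ℕ}
    (hN : ∀ m, N m = 4 ^ m) :
    ∀ᵐ ω ∂P, Tendsto (fun m : ℕ => Real.log (N m) * (arrival e (N m) ω / N m - 1))
      atTop (𝓝 0) := by
  have hNr : ∀ m, (N m : ℝ) = 4 ^ m := fun m => by rw [hN]; push_cast; rfl
  have hpos : ∀ m, (0 : ℝ) < N m := fun m => by rw [hNr]; positivity
  have hlog : ∀ m : ℕ, Real.log (N m) = m * Real.log 4 := by
    intro m; rw [hNr, Real.log_pow]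
  have hl4 : 0 ≤ Real.log 4 := Real.log_nonneg (by norm_num)
  have hsum : ∀ᵐ ω ∂P, Summable fun m : ℕ => ((m * Real.log 4) / (N m : ℝ)) *
      |arrival e (N m) ω - (N m + 1)| := by
    refine ae_summable_of_integral_le (b := fun m : ℕ =>
      (2 * Real.log 4 * (variance (e 0) P + 1)) * ((m : ℝ) ^ 1 * (1 / 2) ^ m))
      (fun m => (he.integrable_abs_arrival_sub _).const_mul _)
      (fun m ω => by positivity) ?_ ?_
    · have hg : Summable fun m : ℕ => (m : ℝ) ^ 1 * (1 / 2 : ℝ) ^ m :=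
        summable_pow_mul_geometric_of_norm_lt_one 1 (by norm_num)
      exact hg.mul_left _
    · intro m
      rw [integral_const_mul]
      have hV : 0 ≤ variance (e 0) P := variance_nonneg _ _
      have hs : √((N m : ℝ) + 1) ≤ 2 * 2 ^ m := by
        rw [Real.sqrt_le_left (by positivity)]
        have : (4 : ℝ) ^ m = (2 ^ m) ^ 2 := by rw [← pow_mul, mul_comm, pow_mul]; norm_num
        have h1 : (1 : ℝ) ≤ 2 ^ m := one_le_pow₀ (by norm_num)
        rw [hNr]
        nlinarith
      have hI := (he.integral_abs_arrival_sub_le (N m)).trans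
        (mul_le_mul_of_nonneg_left hs (by positivity))
      refine (mul_le_mul_of_nonneg_left hI
        (div_nonneg (by positivity) (hpos m).le)).trans_eq ?_
      have : (4 : ℝ) ^ m = 2 ^ m * 2 ^ m := by rw [← mul_pow]; norm_num
      rw [hNr, this, one_div, inv_pow]
      field_simp
  -- This pays for centring at N + 1, the mean of `arrival e N`, instead of N.
  have hz : Tendsto (fun m : ℕ => (m * Real.log 4) / (N m : ℝ)) atTop (𝓝 0) := by
    have := (tendsto_pow_const_mul_const_pow_of_abs_lt_one 1
      (show |(1 / 4 : ℝ)| < 1 by rw [abs_of_pos] <;> norm_num)).mul_const (Real.log 4)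
    rw [zero_mul] at this
    refine this.congr fun m => ?_
    rw [hNr, one_div, inv_pow]
    ring
  filter_upwards [hsum] with ω hω
  refine squeeze_zero_norm (fun m => ?_) (by simpa using hω.tendsto_atTop_zero.add hz)
  have h4 := hpos m
  rw [hlog, norm_mul, Real.norm_of_nonneg (by positivity), Real.norm_eq_abs]
  generalize (N m : ℝ) = x at *
  generalize arrival e (N m) ω = a
  have e1 : a / x - 1 = ((a - (x + 1)) + 1) / x := by
    field_simp; ring
  rw [e1, abs_div, abs_of_pos h4, div_mul_eq_mul_div, ← mul_div_assoc, ← add_div]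
  gcongr
  calc _ ≤ m * Real.log 4 * (|a - (x + 1)| + |1|) := by
        gcongr; exact abs_add_le _ _
    _ = _ := by rw [abs_one]; ring

/-! ### The characteristic function of ζ° -/

lemma prod_expRecip_arrival_mul_exp {Ω : Type*} (e : ℕ → Ω → ℝ) (u : ℝ) (n : ℕ) (ω : Ω) :
    (∏ k ∈ Finset.range n, expRecip u (arrival e k ω)) *
      Complex.exp (-((u * Real.log (arrival e n ω) : ℝ) : ℂ) * Complex.I) =
    Complex.exp (((u * ((∑ k ∈ Finset.range n, zetaTerm e ω k) + harmonic n -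
      Real.log (arrival e n ω)) : ℝ) : ℂ) * Complex.I) := by
  unfold expRecip
  rw [← Complex.exp_sum, ← Complex.exp_add]
  congr 1
  have h1 : ∑ k ∈ Finset.range n, zetaTerm e ω k =
      ∑ k ∈ Finset.range n, (arrival e k ω)⁻¹ - harmonic n := by
    rw [harmonic]
    push_cast
    rw [← Finset.sum_sub_distrib]
    exact Finset.sum_congr rfl fun k _ => by rw [zetaTerm, one_div]; rfl
  rw [h1, sub_add_cancel, ← Finset.sum_mul]
  push_cast
  simp only [div_eq_mul_inv]
  rw [← Finset.mul_sum]
  ring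

/-- The constant γ arises from harmonic n - log n, while log(Γ_{n+1}/n) → 0. -/
lemma tendsto_sum_zetaTerm_sub_log {Ω : Type*} {e : ℕ → Ω → ℝ} {ω : Ω} (hs : Summable (zetaTerm e ω))
    (hp : ∀ n, 0 < arrival e n ω)
    (h1 : Tendsto (fun n : ℕ => arrival e n ω / n) atTop (𝓝 1)) :
    Tendsto (fun n : ℕ => (∑ k ∈ Finset.range n, zetaTerm e ω k) + harmonic n -
      Real.log (arrival e n ω)) atTop (𝓝 (zetaCirc e ω)) := by
  have h2 := (hs.hasSum.tendsto_sum_nat.add Real.tendsto_harmonic_sub_log).sub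
    (h1.log one_ne_zero)
  rw [Real.log_one, sub_zero] at h2
  refine h2.congr' ?_
  filter_upwards [eventually_ne_atTop 0] with n hn
  rw [Real.log_div (hp n).ne' (by exact_mod_cast hn)]
  ring

/-- Both sides of `integral_prod_expRecip_mul_eq` with g(T) = e^{-iu log T} have integrands of norm
at most 1, so dominated convergence along 4^m gives two limits of one sequence. -/
theorem IsIIDStdExp.integral_exp_zetaCirc_of_measurable (he : IsIIDStdExp e P)
    (hm : ∀ s, Measurable (e s)) (u : ℝ) :
    ∫ ω, Complex.exp (((u * zetaCirc e ω : ℝ) : ℂ) * Complex.I) ∂P =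
      Complex.exp (expRecipConst u) := by
  have := he.indep.isProbabilityMeasure
  have hA : ∀ k, Measurable (arrival e k) := measurable_arrival hm
  have hH : Measurable (expRecipInt u) := (continuous_expRecipInt u).measurable
  have hZ : ∀ k, Measurable fun ω => zetaTerm e ω k := fun k =>
    ((hA k).inv).sub_const _
  obtain ⟨N, hN⟩ : ∃ N : ℕ → ℕ, ∀ m, N m = 4 ^ m := ⟨_, fun _ => rfl⟩
  have hNt : Tendsto N atTop atTop := by
    rw [show N = fun m => 4 ^ m from funext hN]
    exact tendsto_pow_atTop_atTop_of_one_lt (by norm_num)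
  have hL : Tendsto (fun m => ∫ ω, Complex.exp (((u * ((∑ k ∈ Finset.range (N m),
      zetaTerm e ω k) + harmonic (N m) - Real.log (arrival e (N m) ω)) : ℝ) : ℂ) * Complex.I) ∂P)
      atTop (𝓝 (∫ ω, Complex.exp (((u * zetaCirc e ω : ℝ) : ℂ) * Complex.I) ∂P)) := by
    refine tendsto_integral_of_dominated_convergence (fun _ => 1)
      (fun m => (by fun_prop : Measurable _).aestronglyMeasurable) (integrable_const _)
      (fun m => ae_of_all _ fun ω => (Complex.norm_exp_ofReal_mul_I _).le) ?_
    filter_upwards [he.ae_summable_zetaTerm, he.ae_arrival_pos, he.ae_tendsto_arrival_div]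
      with ω h1 h2 h3
    exact ((((tendsto_sum_zetaTerm_sub_log h1 h2 h3).comp hNt).const_mul u).ofReal.mul_const
      Complex.I).cexp
  have hR : Tendsto (fun m => ∫ ω, (expRecipInt u (arrival e (N m) ω) / arrival e (N m) ω) ^ N m *
      Complex.exp (-((u * Real.log (arrival e (N m) ω) : ℝ) : ℂ) * Complex.I) ∂P)
      atTop (𝓝 (∫ _, Complex.exp (expRecipConst u) ∂P)) := by
    refine tendsto_integral_of_dominated_convergence (fun _ => 1)
      (fun m => (by fun_prop : Measurable _).aestronglyMeasurable) (integrable_const _)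
      (fun m => ae_of_all _ fun ω => ?_) ?_
    · rw [← Complex.ofReal_neg, norm_mul, Complex.norm_exp_ofReal_mul_I, mul_one, norm_pow,
        norm_div, Complex.norm_real, Real.norm_eq_abs]
      exact pow_le_one₀ (by positivity)
        (div_le_one_of_le₀ (norm_expRecipInt_le u _) (abs_nonneg _))
    · filter_upwards [he.ae_tendsto_arrival_div, he.ae_tendsto_log_mul hN] with ω h1 h2
      exact tendsto_expRecipInt_div_pow u hNt (h1.comp hNt) h2
  rw [integral_const, probReal_univ, one_smul] at hR
  refine tendsto_nhds_unique hL (hR.congr fun m => ?_)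
  rw [← integral_prod_expRecip_mul_eq he hm u (N m)
    (g := fun T => Complex.exp (-((u * Real.log T : ℝ) : ℂ) * Complex.I)) (by fun_prop) (C := 1)
    (fun x => by rw [← Complex.ofReal_neg]; exact (Complex.norm_exp_ofReal_mul_I _).le)]
  simp_rw [prod_expRecip_arrival_mul_exp]

theorem IsIIDStdExp.integral_exp_zetaCirc (he : IsIIDStdExp e P) (u : ℝ) :
    ∫ ω, Complex.exp (((u * zetaCirc e ω : ℝ) : ℂ) * Complex.I) ∂P =
      Complex.exp (expRecipConst u) := by
  -- The variables are only almost everywhere measurable; measurable modifications leave the law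
  -- and, almost surely, ζ° unchanged.
  have hae : ∀ s, e s =ᵐ[P] (he.law s).aemeasurable.mk := fun s =>
    (he.law s).aemeasurable.ae_eq_mk
  have he' : IsIIDStdExp (fun s => (he.law s).aemeasurable.mk) P :=
    ⟨he.indep.congr hae, fun s => (he.law s).congr (hae s).symm⟩
  rw [← he'.integral_exp_zetaCirc_of_measurable (fun s => (he.law s).aemeasurable.measurable_mk) u]
  refine integral_congr_ae ?_
  filter_upwards [ae_all_iff.2 hae] with ω hω
  simp only [zetaCirc, zetaTerm, hω]

end

/-! ### The identity in law -/

theorem theorem4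
    {Ω₀ : Type*} [MeasurableSpace Ω₀] (P₀ : Measure Ω₀) [IsProbabilityMeasure P₀]
    (e : ℕ → Ω₀ → ℝ) (he : IsIIDStdExp e P₀)
    {Ω : Type*} [MeasurableSpace Ω] (P : Measure Ω) [IsProbabilityMeasure P]
    (p : ℕ) (ζ : Fin p → Ω → ℝ)
    (hζ_indep : iIndepFun ζ P)
    (hζ_law : ∀ i, IdentDistrib (ζ i) (zetaCirc e) P P₀)
    (l : Fin p → ℝ) (hl_pos : ∀ i, 0 < l i) (hl_sum : ∑ i, l i = 1) :
    (∀ᵐ ω ∂P₀, Summable (zetaTerm e ω)) ∧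
    ∀ x : ℝ,
      P {ω | (∑ i, l i * ζ i ω) + (∑ i, l i * Real.log (l i)) ≤ x} = P₀ {ω | zetaCirc e ω ≤ x} := by
  refine ⟨he.ae_summable_zetaTerm, fun x => ?_⟩
  have hζm : ∀ i, AEMeasurable (ζ i) P := fun i => (hζ_law i).aemeasurable_fst
  -- An index exists because an empty sum is not 1; its law hypothesis supplies the measurability of
  -- `zetaCirc e`.
  obtain ⟨i₀⟩ : Nonempty (Fin p) := by
    by_contra h
    rw [not_nonempty_iff] at h
    simp at hl_sum
  have hcm : AEMeasurable (zetaCirc e) P₀ := (hζ_law i₀).aemeasurable_snd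
  have hSm : AEMeasurable (fun ω => ∑ i, l i * ζ i ω) P :=
    Finset.aemeasurable_fun_sum _ fun i _ => (hζm i).const_mul _
  have hTm := hSm.add_const (∑ i, l i * Real.log (l i))
  have hchar : ∀ u, charFun (P₀.map (zetaCirc e)) u = Complex.exp (expRecipConst u) := by
    intro u
    rw [charFun_apply_real, integral_map hcm (by fun_prop), ← he.integral_exp_zetaCirc u]
    push_cast
    rfl
  have hmul : ∀ i u, charFun (P.map fun ω => l i * ζ i ω) u =
      Complex.exp (expRecipConst (l i * u)) := by
    intro i u
    rw [← hchar, ← (hζ_law i).map_eq, ← charFun_map_mul,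
      AEMeasurable.map_map_of_aemeasurable (by fun_prop) (hζm i)]
    rfl
  have hlaw : P.map (fun ω => (∑ i, l i * ζ i ω) + ∑ i, l i * Real.log (l i)) =
      P₀.map (zetaCirc e) := by
    have := Measure.isProbabilityMeasure_map hcm
    have := Measure.isProbabilityMeasure_map hTm
    refine Measure.ext_of_charFun (funext fun u => ?_)
    have hsum := congrFun ((hζ_indep.comp (fun i y => l i * y)
      (fun i => by fun_prop)).charFun_map_fun_sum_eq_prod
      (fun i => (hζm i).const_mul (l i))) u
    simp only [Finset.prod_apply, hmul] at hsum
    rw [hchar, charFun_apply_real, integral_map hTm (by fun_prop)]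
    rw [charFun_apply_real, integral_map hSm (by fun_prop)] at hsum
    have e1 : ∀ ω, Complex.exp (u * (((∑ i, l i * ζ i ω) + ∑ i, l i * Real.log (l i) : ℝ) : ℂ) *
        Complex.I) = Complex.exp (u * ((∑ i, l i * ζ i ω : ℝ) : ℂ) * Complex.I) *
        Complex.exp (((u * ∑ i, l i * Real.log (l i) : ℝ) : ℂ) * Complex.I) := by
      intro ω
      rw [← Complex.exp_add]
      push_cast
      ring_nf
    simp_rw [e1]
    rw [integral_mul_const, hsum, ← Complex.exp_sum, ← Complex.exp_add]
    congr 1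
    -- The scaling rule leaves (∑ λ_i) C(u) - iu ∑ λ_i log λ_i, and the shift cancels the second
    -- term.
    simp_rw [expRecipConst_mul u (hl_pos _)]
    rw [Finset.sum_sub_distrib, ← Finset.sum_mul, ← Finset.sum_mul, ← Complex.ofReal_sum, hl_sum,
      ← Complex.ofReal_sum, ← Finset.mul_sum]
    push_cast
    ring
  have h := congrArg (fun μ => μ (Set.Iic x)) hlaw
  simp only [Measure.map_apply_of_aemeasurable hTm measurableSet_Iic,
    Measure.map_apply_of_aemeasurable hcm measurableSet_Iic] at h
  exact h
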